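/- \textbf{Setting.} A \emph{normed cone} is a commutative topological monoid $(K,+,\mathbf e)$ whose topology is Polish, with a jointly continuous multiplication $(a,x)\mapsto ax$ by scalars $a>0$ satisfying $a(x+y)=ax+ay$, $a(bx)=(ab)x$, $1x=x$, $a\mathbf e=\mathbf e$; with a unique element $\mathbf 0$ (the origin, possibly different from $\mathbf e$) such that $ax\to\mathbf 0$ as $a\downarrow 0$ for every $x\ne\mathbf e$; and with a metric $d$, possibly taking the value $\infty$, that induces the topology and satisfies $d(ax,\mathbf 0)=a\,d(x,\mathbf 0)$. Write $\|x\|=d(x,\mathbf 0)$, $S=\{x:\|x\|=1\}$ and $K'=K\setminus\{\mathbf 0,\mathbf e\}$ (on $K'$ the norm is positive and finite). Let $\xi,\xi_1,\xi_2,\dots$ be i.i.d. $K'$-valued random elements, let $\sigma$ be a Borel probability measure on $S$, and let $\beta>\alpha>0$. Assume that for every Borel set $A\subseteq S$ with $\sigma(\partial A)=0$ (boundary in $S$) there is a real constant $C=C_A$ with \[ \mathbf P\Big\{\frac{\xi}{\|\xi\|}\in A,\ \|\xi\|>x\Big\}=\sigma(A)x^{-\alpha}+C_Ax^{-\beta}+o(x^{-\beta})\qquad(x\to\infty).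 \] Put $\zeta=\min\big(\frac{\beta-\alpha}{\alpha},1\big)$ and let $0<\varepsilon<\frac{2\zeta}{1+2\zeta}$. Let $n=n_N$ and $m=m_N$ be natural numbers with \[ n\sim N^{2\zeta/(1+2\zeta)-\varepsilon},\qquad m\sim N^{1/(1+2\zeta)+\varepsilon}\qquad (N\to\infty) \] (for example, the integer parts of the right-hand sides). For each $N$ let $G_{m,1},\dots,G_{m,n}$ be pairwise disjoint groups of $m$ elements each, taken from the sample $\xi_1,\dots,\xi_N$; let $\xi_{m,i}$ be an element of largest norm in $G_{m,i}$, its index being chosen measurably (ties may be broken in any way), and put $\theta_{m,i}=\xi_{m,i}/\|\xi_{m,i}\|$. \textbf{Theorem.} Let $B\subseteq S$ be a Borel set with $\sigma(\partial B)=0$ and $0<\sigma(B)<1$. Put $\eta_{m,i}=\mathbf 1_B(\theta_{m,i})$, $\hat\sigma_N=\frac1n\sum_{i=1}^n\delta_{\theta_{m,i}}$ and \[ T_N=\frac{\sqrt n\,\big(\hat\sigma_N(B)-\sigma(B)\big)}{\Big(\frac1n\sum_{i=1}^n\eta_{m,i}^2-\big(\frac1n\sum_{i=1}^n\eta_{m,i}\big)^2\Big)^{1/2}}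 \] (with, say, $T_N=0$ when the denominator vanishes). Then $T_N$ converges in distribution to $\mathcal N(0,1)$ as $N\to\infty$. -/

import Mathlib

open Filter Topology MeasureTheory ProbabilityTheory Asymptotics
open scoped ENNReal

/-- The multiplicative group of positive real scalars. -/
abbrev PosScalar : Type := {a : ℝ // 0 < a}

/-- A normed cone. `K` is a commutative monoid, written additively, so that the neutral element `e`
is `(0 : K)`; it need not be the origin. `DistribMulAction PosScalar K` says exactly
`a (x + y) = a x + a y`, `a (b x) = (a b) x`, `1 x = x`, `a e = e` for `a, b > 0`. The extended
metric `edist` (infinite values are allowed) induces the topology, which is Polish; addition and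
scaling are continuous; `origin` is the only element with `a x → origin` as `a ↓ 0` for all
`x ≠ e`; and `edist` is homogeneous at the origin. -/
class NormedCone (K : Type*) [AddCommMonoid K] [EMetricSpace K] [DistribMulAction PosScalar K] where
  polish : PolishSpace K
  continuousAdd : ContinuousAdd K
  continuousSMul : ContinuousSMul PosScalar K
  origin : K
  tendsto_origin : ∀ x : K, x ≠ 0 →
    Tendsto (fun a : PosScalar => a • x) (comap Subtype.val (𝓝[>] (0 : ℝ))) (𝓝 origin)
  origin_unique : ∀ y : K,
    (∀ x : K, x ≠ 0 →
      Tendsto (fun a : PosScalar => a • x) (comap Subtype.val (𝓝[>] (0 : ℝ))) (𝓝 y)) → y = origin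
  edist_smul_origin : ∀ (a : PosScalar) (x : K),
    edist (a • x) origin = ENNReal.ofReal a * edist x origin

namespace NormedCone

section Basic

variable {K : Type*} [AddCommMonoid K] [EMetricSpace K] [DistribMulAction PosScalar K]
  [NormedCone K]

/-- The norm `‖x‖ = d(x, origin)`, with values in `[0, ∞]`. -/
noncomputable def coneNorm (x : K) : ℝ≥0∞ := edist x (origin : K)

variable (K) in
/-- The unit sphere `S`. -/
def unitSphere : Set K := {x | coneNorm x = 1}

variable (K) in
/-- `K' = K \ {origin, e}`. -/
def punctured : Set K := {x | x ≠ origin ∧ x ≠ 0}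

theorem coneNorm_smul (a : PosScalar) (x : K) : coneNorm (a • x) = ENNReal.ofReal a * coneNorm x :=
  edist_smul_origin a x

theorem coneNorm_ne_zero {x : K} (hx : x ∈ punctured K) : coneNorm x ≠ 0 := by
  simpa [coneNorm] using hx.1

theorem coneNorm_ne_top {x : K} (hx : x ∈ punctured K) : coneNorm x ≠ ∞ := by
  intro htop
  have hne : (comap (Subtype.val : PosScalar → ℝ) (𝓝[>] (0 : ℝ))).NeBot := by
    rw [comap_neBot_iff_frequently]
    refine Eventually.frequently ?_
    filter_upwards [self_mem_nhdsWithin] with a ha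
    exact ⟨⟨a, ha⟩, rfl⟩
  have h := (tendsto_origin x hx.2).eventually
    (Metric.eball_mem_nhds (origin : K) (ε := 1) one_pos)
  obtain ⟨a, ha⟩ := h.exists
  have h2 : coneNorm (a • x) < 1 := ha
  rw [coneNorm_smul, htop, ENNReal.mul_top (by simpa using a.2)] at h2
  exact absurd h2 (by simp)

/-- The norm on `K'`, where it is positive and finite, as a real number. -/
noncomputable def radius (x : punctured K) : ℝ := (coneNorm (x : K)).toReal

theorem radius_pos (x : punctured K) : 0 < radius x :=
  ENNReal.toReal_pos (coneNorm_ne_zero x.2) (coneNorm_ne_top x.2)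

/-- The direction `x / ‖x‖ ∈ S` of `x ∈ K'`. -/
noncomputable def direction (x : punctured K) : unitSphere K :=
  ⟨(⟨(radius x)⁻¹, inv_pos.2 (radius_pos x)⟩ : PosScalar) • (x : K), by
    have h : coneNorm (x : K) = ENNReal.ofReal (radius x) :=
      (ENNReal.ofReal_toReal (coneNorm_ne_top x.2)).symm
    change coneNorm _ = 1
    rw [coneNorm_smul, h, ← ENNReal.ofReal_mul (inv_nonneg.2 (radius_pos x).le),
      inv_mul_cancel₀ (radius_pos x).ne', ENNReal.ofReal_one]⟩

variable [MeasurableSpace K] {Ω : Type*} [MeasurableSpace Ω]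

/-- The strong second-order tail relation: for every Borel `B ⊆ S` with `σ(∂B) = 0` (boundary in
`S`) there is a real `C`, which may depend on `B`, such that
`P{X/‖X‖ ∈ B, ‖X‖ > x} = σ(B) x^{-α} + C x^{-β} + o(x^{-β})` as `x → ∞`. -/
def StrongSecondOrder (P : Measure Ω) (X : Ω → punctured K) (σ : Measure (unitSphere K))
    (α β : ℝ) : Prop :=
  ∀ B : Set (unitSphere K), MeasurableSet B → σ (frontier B) = 0 → ∃ C : ℝ,
    (fun x : ℝ => P.real {ω | direction (X ω) ∈ B ∧ x < radius (X ω)}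
      - (σ.real B * x ^ (-α) + C * x ^ (-β))) =o[atTop] fun x : ℝ => x ^ (-β)

/-- `J` is a random index of an element of largest norm in the group of the `ξ k`, `k ∈ G`.
Ties may be broken in any measurable way. -/
structure IsMaxIndex (ξ : ℕ → Ω → punctured K) (G : Finset ℕ) (J : Ω → ℕ) : Prop where
  measurable : Measurable J
  mem : ∀ ω, J ω ∈ G
  radius_le : ∀ ω, ∀ k ∈ G, radius (ξ k ω) ≤ radius (ξ (J ω) ω)

/-- The empirical measure `(1/n) ∑_{i<n} δ_{θ i}` on the sphere. -/
noncomputable def spectralEstimator (n : ℕ) (θ : ℕ → unitSphere K) : Measure (unitSphere K) :=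
  (n : ℝ≥0∞)⁻¹ • ∑ i ∈ Finset.range n, Measure.dirac (θ i)

/-- The self-normalized statistic
`√n (σ̂(B) - σ(B)) / ((1/n) ∑ η i ^ 2 - ((1/n) ∑ η i) ^ 2) ^ (1/2)` with `η i = 1_B(θ i)`. -/
noncomputable def selfNormalizedStat (σ : Measure (unitSphere K)) (B : Set (unitSphere K))
    (n : ℕ) (θ : ℕ → unitSphere K) : ℝ :=
  let η : ℕ → ℝ := fun i => B.indicator (fun _ => (1 : ℝ)) (θ i)
  Real.sqrt n * ((spectralEstimator n θ).real B - σ.real B) /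
    Real.sqrt ((1 / (n : ℝ)) * ∑ i ∈ Finset.range n, η i ^ 2
      - ((1 / (n : ℝ)) * ∑ i ∈ Finset.range n, η i) ^ 2)

end Basic

/-- `G 0, …, G (n - 1)` are pairwise disjoint groups of `m` indices each, taken from the `N` sample
indices `0, …, N - 1`. -/
structure IsGrouping (N n m : ℕ) (G : ℕ → Finset ℕ) : Prop where
  subset : ∀ i < n, G i ⊆ Finset.range N
  card_eq : ∀ i < n, (G i).card = m
  disjoint : ∀ i < n, ∀ k < n, i ≠ k → Disjoint (G i) (G k)

end NormedCone

/-! ### Second-order tails, quantiles and the layer-cake estimate for the maximum -/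

section Tail

variable {Ω : Type*} [MeasurableSpace Ω] {P : Measure Ω} {R : Ω → ℝ}

/-! The direction of a group's maximum lies in `B` with probability `σ(B) + O(m^{-ζ})`, and `√n
m^{-ζ} → 0`, so the bias is negligible against the fluctuations of a sum of `n` indicators.

With ties broken arbitrarily, the `θ_{m,i}` may depend on several groups and need be neither
independent nor identically distributed. They are therefore compared with the events `E_i` that
group `i` has a strict maximum with direction in `B` (`strictMaxEvent`). Each `E_i` depends on its
own group only, so these events are independent (`iIndepSet_strictMaxEvent`), and all have
probability `m E[1_B F(R)^{m-1}]` with `F(x) = P(R < x)` (`measureReal_strictMaxEvent`). The tail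
relation bounds this below by `σ(B) - O(m^{-ζ})` (`exists_tail_lower_bound`,
`quantile_tail_lower_bound`, `integral_pow_lower_bound`).

Only lower bounds are needed: `E_i` forces `θ_{m,i} ∈ B`, the analogous event for `Bᶜ` forces
`θ_{m,i} ∉ B`, and the two lower bounds add up to `1 - O(m^{-ζ})`. This gives the upper bound as
well and shows that ties cost only `O(m^{-ζ})`. The indicators of the `E_i` satisfy a
triangular-array central limit theorem (`tendstoInDistribution_array`), the difference from the
`η_{m,i}` vanishes in `L¹` after scaling by `√n`, and Slutsky's theorem handles the random
denominator (`tendstoInDistribution_selfNormalized`). -/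

theorem tail_bounds_of_second_order {E : Set Ω} {s α β : ℝ} {C : ℝ}
    (h : (fun x : ℝ => P.real (E ∩ {ω | x < R ω}) - (s * x ^ (-α) + C * x ^ (-β)))
      =o[atTop] fun x : ℝ => x ^ (-β)) :
    ∃ K : ℝ, 0 ≤ K ∧ ∀ᶠ x in atTop, |P.real (E ∩ {ω | x < R ω}) - s * x ^ (-α)| ≤ K * x ^ (-β) := by
  refine ⟨1 + |C|, by positivity, ?_⟩
  filter_upwards [h.def one_pos, eventually_gt_atTop 0] with x hx h0
  have hp : 0 < x ^ (-β) := Real.rpow_pos_of_pos h0 _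
  rw [Real.norm_eq_abs, Real.norm_eq_abs, abs_of_pos hp, one_mul] at hx
  have h1 : |C * x ^ (-β)| = |C| * x ^ (-β) := by rw [abs_mul, abs_of_pos hp]
  have h2 := abs_add_le (P.real (E ∩ {ω | x < R ω}) - (s * x ^ (-α) + C * x ^ (-β))) (C * x ^ (-β))
  calc |P.real (E ∩ {ω | x < R ω}) - s * x ^ (-α)|
      = |(P.real (E ∩ {ω | x < R ω}) - (s * x ^ (-α) + C * x ^ (-β))) + C * x ^ (-β)| := by
        congr 1; ring
    _ ≤ (1 + |C|) * x ^ (-β) := by linarith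

variable [IsProbabilityMeasure P]

/-- A second-order expansion of the tail bounds `P(E, R > x)` from below in terms of the two tails
of `R`, at every level `x`; the possible atom of `R` at `x` is absorbed by the error term. -/
theorem exists_tail_lower_bound {E : Set Ω} {s α β C C' : ℝ}
    (hα : 0 < α) (hαβ : α < β) (hs0 : 0 ≤ s) (hs1 : s ≤ 1)
    (hE : (fun x : ℝ => P.real (E ∩ {ω | x < R ω}) - (s * x ^ (-α) + C * x ^ (-β)))
      =o[atTop] fun x : ℝ => x ^ (-β))
    (hU : (fun x : ℝ => P.real {ω | x < R ω} - (1 * x ^ (-α) + C' * x ^ (-β)))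
      =o[atTop] fun x : ℝ => x ^ (-β)) :
    ∃ D : ℝ, 0 ≤ D ∧ ∀ x : ℝ, s * P.real {ω | x ≤ R ω} - D * P.real {ω | x < R ω} ^ (β / α)
      ≤ P.real (E ∩ {ω | x < R ω}) := by
  obtain ⟨K₁, hK₁, h1⟩ := tail_bounds_of_second_order hE
  obtain ⟨K₂, hK₂, h2⟩ := tail_bounds_of_second_order (P := P) (R := R) (E := Set.univ)
    (s := 1) (α := α) (β := β) (C := C') (by simpa only [Set.univ_inter] using hU)
  simp only [Set.univ_inter, one_mul] at h2
  -- Beyond some `x₀` the error `K₂ x^{-β}` is at most half of `x^{-α}`, so `P(R > x) ≥ x^{-α} / 2`,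
  -- and powers of `x` can be traded for powers of the tail.
  have hlim : Tendsto (fun x : ℝ => K₂ * x ^ (-(β - α))) atTop (𝓝 0) := by
    simpa using (tendsto_rpow_neg_atTop (sub_pos.2 hαβ)).const_mul K₂
  have h3 := hlim.eventually_lt_const (show (0 : ℝ) < 1 / 2 by norm_num)
  obtain ⟨x₀, hx₀⟩ := eventually_atTop.1 (h1.and (h2.and (h3.and (eventually_gt_atTop 0))))
  have hγ : 0 < β / α := div_pos (hα.trans hαβ) hα
  have hpos : ∀ x ≥ x₀, 0 < x := fun x hx => (hx₀ x hx).2.2.2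
  have hlow : ∀ x ≥ x₀, x ^ (-α) / 2 ≤ P.real {ω | x < R ω} := by
    intro x hx
    obtain ⟨-, hb, hc, h0⟩ := hx₀ x hx
    have : K₂ * x ^ (-β) = K₂ * x ^ (-(β - α)) * x ^ (-α) := by
      rw [mul_assoc, ← Real.rpow_add h0]; congr 2; ring
    have hp : 0 < x ^ (-α) := Real.rpow_pos_of_pos h0 _
    have := (abs_le.1 hb).1
    nlinarith
  -- The bound for `P(R > y)` is continuous in `y`; letting `y ↑ x` transfers it to `P(R ≥ x)`, atom
  -- included.
  have hup : ∀ x > x₀, P.real {ω | x ≤ R ω} ≤ x ^ (-α) + K₂ * x ^ (-β) := by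
    intro x hx
    have hx0 := hpos x hx.le
    have hc : ContinuousAt (fun y : ℝ => y ^ (-α) + K₂ * y ^ (-β)) x :=
      (Real.continuousAt_rpow_const _ _ (Or.inl hx0.ne')).add
        ((Real.continuousAt_rpow_const _ _ (Or.inl hx0.ne')).const_mul _)
    refine ge_of_tendsto (hc.tendsto.mono_left (nhdsWithin_le_nhds (s := Set.Iio x))) ?_
    filter_upwards [self_mem_nhdsWithin, Ioo_mem_nhdsLT hx] with y hy hy'
    have := (abs_le.1 (hx₀ y hy'.1.le).2.1).2
    have hm : P.real {ω | x ≤ R ω} ≤ P.real {ω | y < R ω} :=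
      measureReal_mono fun ω (hω : x ≤ R ω) => lt_of_lt_of_le hy hω
    linarith
  set x₁ := x₀ + 1
  have hx₁ : x₀ < x₁ := by simp [x₁]
  set p := P.real {ω | x₁ < R ω}
  have hp : 0 < p :=
    lt_of_lt_of_le (half_pos (Real.rpow_pos_of_pos (hpos _ hx₁.le) _)) (hlow _ hx₁.le)
  -- The first summand serves `x ≥ x₁`. The second serves `x < x₁`: there `P(R > x) ≥ p`, so the
  -- subtracted term is at least `1` and the left side is nonpositive.
  refine ⟨(K₁ + K₂) * 2 ^ (β / α) + (p ^ (β / α))⁻¹, by positivity, fun x => ?_⟩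
  rcases lt_or_ge x x₁ with hx | hx
  · have hq : p ^ (β / α) ≤ P.real {ω | x < R ω} ^ (β / α) :=
      Real.rpow_le_rpow hp.le (measureReal_mono fun ω (hω : x₁ < R ω) => hx.trans hω) hγ.le
    have h4 : 1 ≤ (p ^ (β / α))⁻¹ * P.real {ω | x < R ω} ^ (β / α) := by
      rw [inv_mul_eq_div, one_le_div (Real.rpow_pos_of_pos hp _)]; exact hq
    have h5 : s * P.real {ω | x ≤ R ω} ≤ 1 :=
      mul_le_one₀ hs1 measureReal_nonneg measureReal_le_one
    have h6 : 0 ≤ (K₁ + K₂) * 2 ^ (β / α) * P.real {ω | x < R ω} ^ (β / α) := by positivity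
    have h7 : 0 ≤ P.real (E ∩ {ω | x < R ω}) := measureReal_nonneg
    linarith
  · have hx' : x₀ < x := hx₁.trans_le hx
    have h0 := hpos x hx'.le
    have ha := (abs_le.1 (hx₀ x hx'.le).1).1
    have hb := hup x hx'
    have hpow : x ^ (-β) ≤ 2 ^ (β / α) * P.real {ω | x < R ω} ^ (β / α) := by
      rw [← Real.mul_rpow (by norm_num) measureReal_nonneg]
      have : x ^ (-β) = (x ^ (-α)) ^ (β / α) := by
        rw [← Real.rpow_mul h0.le]; congr 1; field_simp
      rw [this]
      exact Real.rpow_le_rpow (Real.rpow_nonneg h0.le _) (by linarith [hlow x hx'.le]) hγ.le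
    have hnn : 0 ≤ x ^ (-β) := Real.rpow_nonneg h0.le _
    have h5 : s * P.real {ω | x ≤ R ω} ≤ s * x ^ (-α) + K₂ * x ^ (-β) := by
      have := mul_le_mul_of_nonneg_left hb hs0
      have : s * (K₂ * x ^ (-β)) ≤ K₂ * x ^ (-β) := mul_le_of_le_one_left (by positivity) hs1
      linarith
    have h6 := mul_le_mul_of_nonneg_left hpow (add_nonneg hK₁ hK₂)
    have h7 : 0 ≤ (p ^ (β / α))⁻¹ * P.real {ω | x < R ω} ^ (β / α) := by positivity
    linarith

/-- A `t`-quantile of a positive random variable, described by its left-continuous distribution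
function. -/
theorem exists_quantile (hR : Measurable R) (hR0 : ∀ ω, 0 < R ω) {t : ℝ} (ht0 : 0 ≤ t)
    (ht1 : t < 1) :
    ∃ a : ℝ, P.real {ω | a < R ω} ≤ 1 - t ∧ 1 - t ≤ P.real {ω | a ≤ R ω} ∧
      ∀ x, a < x → t < P.real {ω | R ω < x} := by
  have hms : ∀ x, MeasurableSet {ω | R ω < x} := fun x => measurableSet_lt hR measurable_const
  have hcompl : ∀ x, P.real {ω | x ≤ R ω} = 1 - P.real {ω | R ω < x} := fun x => by
    rw [← probReal_compl_eq_one_sub (hms x)]; congr 1; ext ω; simp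
  have hmono : ∀ x y, x ≤ y → P.real {ω | R ω < x} ≤ P.real {ω | R ω < y} := fun x y hxy =>
    measureReal_mono fun ω (hω : R ω < x) => hω.trans_le hxy
  -- The quantile is `sSup S`: positivity of `R` puts `0` in `S`, and `t < 1` bounds `S` above.
  set S : Set ℝ := {x | P.real {ω | R ω < x} ≤ t}
  have hne : S.Nonempty := by
    refine ⟨0, ?_⟩
    have : {ω | R ω < 0} = ∅ := by ext ω; simpa using (hR0 ω).le
    simpa [S, this] using ht0
  have hbdd : BddAbove S := by
    by_contra hcon
    have hall : ∀ x, P.real {ω | R ω < x} ≤ t := fun x => by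
      obtain ⟨y, hy, hxy⟩ := not_bddAbove_iff.1 hcon x
      exact (hmono x y hxy.le).trans hy
    have hun : ⋃ k : ℕ, {ω | R ω < k} = Set.univ := by
      ext ω; simpa using exists_nat_gt (R ω)
    have hle : P Set.univ ≤ ENNReal.ofReal t := by
      have hmon : Monotone fun k : ℕ => {ω | R ω < k} := fun i j hij ω (hω : R ω < i) =>
        hω.trans_le (Nat.cast_le.2 hij)
      rw [← hun, hmon.measure_iUnion]
      refine iSup_le fun k => ?_
      rw [← ENNReal.ofReal_toReal (measure_ne_top P _)]
      exact ENNReal.ofReal_le_ofReal (hall k)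
    rw [measure_univ, ENNReal.one_le_ofReal] at hle
    linarith
  have hgt : ∀ x, sSup S < x → t < P.real {ω | R ω < x} := fun x hx => by
    by_contra hcon
    exact absurd (le_csSup hbdd (not_lt.1 hcon : x ∈ S)) (not_le.2 hx)
  refine ⟨sSup S, ?_, ?_, hgt⟩
  · have hun : {ω | sSup S < R ω} = ⋃ k : ℕ, {ω | sSup S + 1 / ((k : ℝ) + 1) ≤ R ω} := by
      ext ω
      simp only [Set.mem_ofPred_eq, Set.mem_iUnion]
      constructor
      · intro h
        obtain ⟨k, hk⟩ := exists_nat_one_div_lt (sub_pos.2 h)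
        exact ⟨k, by linarith⟩
      · rintro ⟨k, hk⟩
        have : 0 < 1 / ((k : ℝ) + 1) := by positivity
        linarith
    have hle : P {ω | sSup S < R ω} ≤ ENNReal.ofReal (1 - t) := by
      rw [hun, Monotone.measure_iUnion]
      · refine iSup_le fun k => ?_
        rw [← ENNReal.ofReal_toReal (measure_ne_top P _)]
        refine ENNReal.ofReal_le_ofReal ?_
        have hk := hgt (sSup S + 1 / ((k : ℝ) + 1)) (by simp; positivity)
        have := hcompl (sSup S + 1 / ((k : ℝ) + 1))
        rw [measureReal_def] at this
        linarith
      · intro i j hij ω (hω : sSup S + 1 / ((i : ℝ) + 1) ≤ R ω)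
        exact le_trans (by gcongr) hω
    exact ENNReal.toReal_le_of_le_ofReal (by linarith) hle
  · rw [hcompl]
    have hun : {ω | R ω < sSup S} = ⋃ k : ℕ, {ω | R ω < sSup S - 1 / ((k : ℝ) + 1)} := by
      ext ω
      simp only [Set.mem_ofPred_eq, Set.mem_iUnion]
      constructor
      · intro h
        obtain ⟨k, hk⟩ := exists_nat_one_div_lt (sub_pos.2 h)
        exact ⟨k, by linarith⟩
      · rintro ⟨k, hk⟩
        have : 0 < 1 / ((k : ℝ) + 1) := by positivity
        linarith
    have hle : P {ω | R ω < sSup S} ≤ ENNReal.ofReal t := by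
      rw [hun, Monotone.measure_iUnion]
      · refine iSup_le fun k => ?_
        rw [← ENNReal.ofReal_toReal (measure_ne_top P _)]
        refine ENNReal.ofReal_le_ofReal ?_
        have hlt : sSup S - 1 / ((k : ℝ) + 1) < sSup S := by simp; positivity
        obtain ⟨y, hy, hky⟩ := exists_lt_of_lt_csSup hne hlt
        exact (hmono _ y hky.le).trans hy
      · intro i j hij ω (hω : R ω < sSup S - 1 / ((i : ℝ) + 1))
        exact lt_of_lt_of_le hω (by gcongr)
    have := ENNReal.toReal_le_of_le_ofReal ht0 hle
    rw [measureReal_def]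
    linarith

/-- At a `t`-quantile `a` the two tails straddle `1 - t`: the term with coefficient `s` uses `P(R ≥
a) ≥ 1 - t`, the error term uses `P(R > a) ≤ 1 - t`, and `R > a` forces `F(R) > t`. No continuity of
the law of `R` is needed. -/
theorem quantile_tail_lower_bound (hR : Measurable R) (hR0 : ∀ ω, 0 < R ω) {E : Set Ω}
    {s D γ : ℝ} (hs0 : 0 ≤ s) (hD : 0 ≤ D) (hγ : 0 ≤ γ)
    (h : ∀ x : ℝ, s * P.real {ω | x ≤ R ω} - D * P.real {ω | x < R ω} ^ γ
      ≤ P.real (E ∩ {ω | x < R ω})) {t : ℝ} (ht0 : 0 ≤ t) (ht1 : t < 1) :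
    s * (1 - t) - D * (1 - t) ^ γ ≤ P.real (E ∩ {ω | t < P.real {ω' | R ω' < R ω}}) := by
  obtain ⟨a, h1, h2, h3⟩ := exists_quantile (P := P) hR hR0 ht0 ht1
  calc s * (1 - t) - D * (1 - t) ^ γ
      ≤ s * P.real {ω | a ≤ R ω} - D * P.real {ω | a < R ω} ^ γ := by gcongr
    _ ≤ P.real (E ∩ {ω | a < R ω}) := h a
    _ ≤ _ := measureReal_mono (Set.inter_subset_inter_right _ fun ω hω => h3 _ hω)

/-- This follows from `(m u)^ζ ≤ 1 + m u`. It replaces a fractional power by a quadratic polynomial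
with the rate `m^{-ζ}` in front, so that only elementary Beta integrals occur later. -/
theorem rpow_one_add_le {ζ u : ℝ} (hζ0 : 0 ≤ ζ) (hζ1 : ζ ≤ 1) (hu : 0 ≤ u) {m : ℝ} (hm : 0 < m) :
    u ^ (1 + ζ) ≤ m ^ (-ζ) * u + m ^ (-ζ) * m * u ^ 2 := by
  have h1 : (m * u) ^ ζ ≤ 1 + m * u := by
    have hmu : 0 ≤ m * u := by positivity
    rcases le_total (m * u) 1 with h | h
    · linarith [Real.rpow_le_one hmu h hζ0]
    · have := Real.rpow_le_rpow_of_exponent_le h hζ1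
      rw [Real.rpow_one] at this
      linarith
  have h2 : u ^ (1 + ζ) = m ^ (-ζ) * u * (m * u) ^ ζ := by
    rw [Real.mul_rpow hm.le hu, Real.rpow_neg hm.le, Real.rpow_add_of_nonneg hu zero_le_one hζ0,
      Real.rpow_one]
    have := (Real.rpow_pos_of_pos hm ζ).ne'
    field_simp
  rw [h2]
  have : 0 ≤ m ^ (-ζ) * u := by positivity
  nlinarith

theorem integral_beta_quadratic (k : ℕ) (a b : ℝ) :
    ∫ t in (0 : ℝ)..1, (a * (1 - t) - b * (1 - t) ^ 2) * (((k : ℝ) + 1) * t ^ k)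
      = a / (k + 2) - 2 * b / ((k + 2) * (k + 3)) := by
  have hderiv : ∀ t : ℝ, HasDerivAt (fun t : ℝ => (a - b) * t ^ (k + 1)
      - (a - 2 * b) * ((k + 1) / (k + 2)) * t ^ (k + 2) - b * ((k + 1) / (k + 3)) * t ^ (k + 3))
      ((a * (1 - t) - b * (1 - t) ^ 2) * (((k : ℝ) + 1) * t ^ k)) t := by
    intro t
    refine ((((hasDerivAt_pow (k + 1) t).const_mul (a - b)).sub
      ((hasDerivAt_pow (k + 2) t).const_mul ((a - 2 * b) * ((k + 1) / (k + 2))))).sub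
      ((hasDerivAt_pow (k + 3) t).const_mul (b * ((k + 1) / (k + 3))))).congr_deriv ?_
    rw [show k + 1 - 1 = k from rfl, show k + 2 - 1 = k + 1 from rfl,
      show k + 3 - 1 = k + 2 from rfl]
    push_cast
    field_simp
    ring
  rw [intervalIntegral.integral_eq_sub_of_hasDerivAt (fun t _ => hderiv t)
    (Continuous.intervalIntegrable (by fun_prop) _ _)]
  simp
  field_simp
  ring

theorem measurable_measureReal_lt : Measurable fun x => P.real {ω | R ω < x} :=
  Monotone.measurable fun _ _ hxy =>
    measureReal_mono fun _ hω => lt_of_lt_of_le hω hxy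

/-- If `P(E, F(R) > t)` is at least `s (1 - t) - D (1 - t) ^ (1 + ζ)`, then the maximum of a sample
of size `m` is strict and lies in `E` with probability at least `s - O(m ^ (-ζ))`. -/
theorem integral_pow_lower_bound (hR : Measurable R) {E : Set Ω}
    {s D ζ : ℝ} (hD : 0 ≤ D) (hζ0 : 0 ≤ ζ) (hζ1 : ζ ≤ 1)
    (h : ∀ t : ℝ, 0 ≤ t → t < 1 → s * (1 - t) - D * (1 - t) ^ (1 + ζ)
      ≤ P.real (E ∩ {ω | t < P.real {ω' | R ω' < R ω}})) {m : ℕ} (hm : 2 ≤ m) :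
    s - 3 * D * (m : ℝ) ^ (-ζ)
      ≤ m * ∫ ω in E, P.real {ω' | R ω' < R ω} ^ (m - 1) ∂P := by
  obtain ⟨k, rfl⟩ : ∃ k, m = k + 2 := ⟨m - 2, by omega⟩
  set M : ℝ := ((k + 2 : ℕ) : ℝ) with hM
  have hMk : M = k + 2 := by simp [hM]
  have hM0 : 0 < M := by rw [hMk]; positivity
  set f : Ω → ℝ := fun ω => P.real {ω' | R ω' < R ω} with hf
  have hfm : Measurable f := measurable_measureReal_lt.comp hR
  have hf0 : ∀ ω, 0 ≤ f ω := fun ω => measureReal_nonneg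
  have hf1 : ∀ ω, f ω ≤ 1 := fun ω => measureReal_le_one
  set g : ℝ → ℝ := fun t => ((k : ℝ) + 1) * t ^ k with hg
  set φ : ℝ → ℝ := fun t => (s - D * M ^ (-ζ)) * (1 - t) - (D * M ^ (-ζ) * M) * (1 - t) ^ 2 with hφ
  -- Layer cake with `g` the derivative of `t^{m-1}`: the integral of `F(R)^{m-1}` over `E` becomes
  -- an integral of `P(E, F(R) > t)`.
  have hcake := lintegral_comp_eq_lintegral_meas_lt_mul (P.restrict E) (f := f) (g := g)
    (ae_of_all _ hf0) hfm.aemeasurable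
    (fun t _ => Continuous.intervalIntegrable (by fun_prop) _ _)
    (by
      filter_upwards [ae_restrict_mem measurableSet_Ioi] with t ht
      have : (0 : ℝ) < t := ht
      positivity)
  have hint : ∀ x : ℝ, ∫ t in (0 : ℝ)..x, g t = x ^ (k + 1) := by
    intro x
    simp only [hg, intervalIntegral.integral_const_mul, integral_pow]
    field_simp
    simp
  simp only [hint] at hcake
  have hI : Integrable (fun ω => f ω ^ (k + 1)) (P.restrict E) := by
    refine Integrable.of_bound (hfm.pow_const _).aestronglyMeasurable 1 (ae_of_all _ fun ω => ?_)
    rw [Real.norm_eq_abs, abs_of_nonneg (pow_nonneg (hf0 ω) _)]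
    exact pow_le_one₀ (hf0 ω) (hf1 ω)
  rw [← ofReal_integral_eq_lintegral_ofReal hI (ae_of_all _ fun ω => pow_nonneg (hf0 ω) _)] at hcake
  have hφg : Continuous fun t => φ t * g t := by fun_prop
  have hlow : ENNReal.ofReal (∫ t in Set.Ioc (0 : ℝ) 1, φ t * g t)
      ≤ ENNReal.ofReal (∫ ω in E, f ω ^ (k + 1) ∂P) := by
    rw [hcake]
    have hIφ : IntegrableOn (fun t => φ t * g t) (Set.Ioc 0 1) :=
      (hφg.integrableOn_Icc (a := 0) (b := 1)).mono_set Set.Ioc_subset_Icc_self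
    -- The minorant `φ` may be negative; passing to the positive part allows the comparison to be
    -- made in `ℝ≥0∞`.
    calc ENNReal.ofReal (∫ t in Set.Ioc (0 : ℝ) 1, φ t * g t)
        ≤ ENNReal.ofReal (∫ t in Set.Ioc (0 : ℝ) 1, max (φ t * g t) 0) :=
          ENNReal.ofReal_le_ofReal (integral_mono hIφ hIφ.pos_part fun t => le_max_left _ _)
      _ = ∫⁻ t in Set.Ioc (0 : ℝ) 1, ENNReal.ofReal (max (φ t * g t) 0) :=
          ofReal_integral_eq_lintegral_ofReal hIφ.pos_part (ae_of_all _ fun t => le_max_right _ _)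
      _ ≤ ∫⁻ t in Set.Ioc (0 : ℝ) 1, (P.restrict E) {ω | t < f ω} * ENNReal.ofReal (g t) := by
          refine setLIntegral_mono' measurableSet_Ioc fun t ht => ?_
          have hg0 : 0 ≤ g t := by
            have := ht.1.le
            positivity
          have hmax : ENNReal.ofReal (max (φ t * g t) 0) = ENNReal.ofReal (φ t * g t) := by
            rw [ENNReal.ofReal_max]; simp
          rw [hmax, ENNReal.ofReal_mul' hg0]
          gcongr
          rw [Measure.restrict_apply (measurableSet_lt measurable_const hfm), Set.inter_comm]
          refine ENNReal.ofReal_le_of_le_toReal ?_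
          rcases lt_or_eq_of_le ht.2 with h1 | rfl
          · refine le_trans ?_ (h t ht.1.le h1)
            have := mul_le_mul_of_nonneg_left
              (rpow_one_add_le hζ0 hζ1 (sub_nonneg.2 h1.le) hM0) hD
            simp only [hφ]
            linarith
          · simp [hφ]
      _ ≤ ∫⁻ t in Set.Ioi (0 : ℝ), (P.restrict E) {ω | t < f ω} * ENNReal.ofReal (g t) :=
          lintegral_mono_set Set.Ioc_subset_Ioi_self
  have hlow' := (ENNReal.ofReal_le_ofReal_iff
    (integral_nonneg fun ω => pow_nonneg (hf0 ω) _)).1 hlow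
  rw [← intervalIntegral.integral_of_le zero_le_one] at hlow'
  simp only [hφ, hg] at hlow'
  rw [integral_beta_quadratic] at hlow'
  have hfin := mul_le_mul_of_nonneg_left hlow' hM0.le
  have heq : k + 2 - 1 = k + 1 := rfl
  rw [heq]
  refine le_trans ?_ hfin
  have hMζ : 0 ≤ D * M ^ (-ζ) := by positivity
  rw [hMk] at hMζ ⊢
  set c := D * ((k : ℝ) + 2) ^ (-ζ)
  have h3 : 3 * D * ((k : ℝ) + 2) ^ (-ζ) = 3 * c := by simp only [c]; ring
  -- The constant `3` is one `c` from the linear term of `φ` plus at most `2 c` from the quadratic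
  -- one.
  have h4 : ((k : ℝ) + 2) * ((s - c) / (k + 2) - 2 * (c * (k + 2)) / ((k + 2) * (k + 3)))
      = s - c - 2 * c * ((k + 2) / (k + 3)) := by field_simp
  rw [h3, h4]
  have h5 : ((k : ℝ) + 2) / (k + 3) ≤ 1 := by rw [div_le_one (by positivity)]; linarith
  nlinarith

end Tail

/-! ### Strict maxima of disjoint groups -/

section StrictMax

variable {Ω S : Type*} [mΩ : MeasurableSpace Ω] [mS : MeasurableSpace S] {P : Measure Ω}
  [IsProbabilityMeasure P] {ξ : ℕ → Ω → S} {ρ : S → ℝ} {D : Set S}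

/-- The event that, among the `ξ k` with `k ∈ G`, there is one with strictly largest `ρ`, and that
it lies in `D`. -/
def strictMaxEvent (ξ : ℕ → Ω → S) (ρ : S → ℝ) (D : Set S) (G : Finset ℕ) : Set Ω :=
  ⋃ k ∈ G, ξ k ⁻¹' D ∩ ⋂ j ∈ G.erase k, {ω | ρ (ξ j ω) < ρ (ξ k ω)}

-- The σ-algebra on `Ω` is left free so that the lemma also applies to the σ-algebra generated by
-- one group.
omit mΩ in
theorem measurableSet_strictMaxEvent (hρ : Measurable ρ) (hD : MeasurableSet D) {G : Finset ℕ}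
    (mΩ' : MeasurableSpace Ω) (hξ : ∀ k ∈ G, Measurable[mΩ'] (ξ k)) :
    MeasurableSet[mΩ'] (strictMaxEvent ξ ρ D G) :=
  Finset.measurableSet_biUnion _ fun k hk => (hξ k hk hD).inter <|
    Finset.measurableSet_biInter _ fun j hj =>
      measurableSet_lt (hρ.comp (hξ j (Finset.mem_of_mem_erase hj))) (hρ.comp (hξ k hk))

/-- Fubini for the product law of `ξ k` and the family over `G`: with `ξ k` fixed, the constraints
on the other variables are independent and equally likely. -/
theorem measure_strictMax_at (hξ : ∀ k, Measurable (ξ k)) (hindep : iIndepFun ξ P)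
    (hident : ∀ k, IdentDistrib (ξ k) (ξ 0) P P) (hρ : Measurable ρ) (hD : MeasurableSet D)
    {G : Finset ℕ} {k : ℕ} (hk : k ∉ G) :
    P (ξ k ⁻¹' D ∩ ⋂ j ∈ G, {ω | ρ (ξ j ω) < ρ (ξ k ω)})
      = ∫⁻ ω in ξ 0 ⁻¹' D, P {ω' | ρ (ξ 0 ω') < ρ (ξ 0 ω)} ^ G.card ∂P := by
  set Y : Ω → (G → S) := fun ω j => ξ j ω
  have hY : Measurable Y := measurable_pi_lambda _ fun j => hξ j
  have hXY : IndepFun (ξ k) Y P := by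
    have := hindep.indepFun_finset {k} G (by simpa using hk) hξ
    exact this.comp (φ := fun x : (({k} : Finset ℕ) → S) => x ⟨k, by simp⟩) (ψ := id)
      (measurable_pi_apply _) measurable_id
  set A : Set (S × (G → S)) := Prod.fst ⁻¹' D ∩ ⋂ j : G, {p | ρ (p.2 j) < ρ p.1}
  have hA : MeasurableSet A := by
    refine (measurable_fst hD).inter (MeasurableSet.iInter fun j => measurableSet_lt ?_ ?_)
    · exact hρ.comp ((measurable_pi_apply j).comp measurable_snd)
    · exact hρ.comp measurable_fst
  have hpre : ξ k ⁻¹' D ∩ ⋂ j ∈ G, {ω | ρ (ξ j ω) < ρ (ξ k ω)} = (fun ω => (ξ k ω, Y ω)) ⁻¹' A := by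
    ext ω; simp [A, Y]
  have hsec : ∀ c : ℝ, P.map Y (⋂ j : G, {y | ρ (y j) < c}) = P {ω' | ρ (ξ 0 ω') < c} ^ G.card := by
    intro c
    have hms : MeasurableSet (⋂ j : G, {y : G → S | ρ (y j) < c}) :=
      MeasurableSet.iInter fun j => (hρ.comp (measurable_pi_apply j)) measurableSet_Iio
    rw [Measure.map_apply hY hms]
    have : Y ⁻¹' (⋂ j : G, {y | ρ (y j) < c}) = ⋂ j ∈ G, ξ j ⁻¹' (ρ ⁻¹' Set.Iio c) := by
      ext ω; simp [Y]
    rw [this, hindep.measure_inter_preimage_eq_mul _ fun j _ => hρ measurableSet_Iio]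
    rw [Finset.prod_congr rfl fun j _ => (hident j).measure_mem_eq (hρ measurableSet_Iio)]
    simp [Set.preimage]
  rw [hpre, ← Measure.map_apply ((hξ k).prodMk hY) hA,
    (indepFun_iff_map_prod_eq_prod_map_map (hξ k).aemeasurable hY.aemeasurable).1 hXY,
    Measure.prod_apply hA, (hident k).map_eq, ← lintegral_indicator (hξ 0 hD),
    lintegral_map (measurable_measure_prodMk_left hA) (hξ 0)]
  refine lintegral_congr fun ω => ?_
  by_cases hω : ξ 0 ω ∈ D
  · rw [Set.indicator_of_mem (by exact hω), ← hsec]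
    congr 1
    ext y
    simp [A, hω]
  · rw [Set.indicator_of_notMem (by exact hω)]
    convert measure_empty (μ := P.map Y)
    ext y
    simp [A, hω]

/-- Strictness makes the events for different `k` disjoint, so the probabilities add exactly. The
result depends on `G` only through its size. -/
theorem measureReal_strictMaxEvent (hξ : ∀ k, Measurable (ξ k)) (hindep : iIndepFun ξ P)
    (hident : ∀ k, IdentDistrib (ξ k) (ξ 0) P P) (hρ : Measurable ρ) (hD : MeasurableSet D)
    (G : Finset ℕ) :
    P.real (strictMaxEvent ξ ρ D G)
      = G.card * ∫ ω in ξ 0 ⁻¹' D, P.real {ω' | ρ (ξ 0 ω') < ρ (ξ 0 ω)} ^ (G.card - 1) ∂P := by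
  have hdisj : (G : Set ℕ).PairwiseDisjoint fun k =>
      ξ k ⁻¹' D ∩ ⋂ j ∈ G.erase k, {ω | ρ (ξ j ω) < ρ (ξ k ω)} := by
    intro k hk l hl hkl
    refine Set.disjoint_left.2 fun ω h1 h2 => ?_
    simp only [Set.mem_inter_iff, Set.mem_iInter] at h1 h2
    have h3 : ρ (ξ l ω) < ρ (ξ k ω) := h1.2 l (Finset.mem_erase.2 ⟨hkl.symm, hl⟩)
    have h4 : ρ (ξ k ω) < ρ (ξ l ω) := h2.2 k (Finset.mem_erase.2 ⟨hkl, hk⟩)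
    exact lt_asymm h3 h4
  have hmeas : ∀ k ∈ G, MeasurableSet
      (ξ k ⁻¹' D ∩ ⋂ j ∈ G.erase k, {ω | ρ (ξ j ω) < ρ (ξ k ω)}) := fun k _ =>
    (hξ k hD).inter <| Finset.measurableSet_biInter _ fun j _ =>
      measurableSet_lt (hρ.comp (hξ j)) (hρ.comp (hξ k))
  have hF : Measurable fun ω => P {ω' | ρ (ξ 0 ω') < ρ (ξ 0 ω)} :=
    (Monotone.measurable (f := fun x => P {ω' | ρ (ξ 0 ω') < x}) fun x y hxy =>
      measure_mono fun ω (hω : _ < x) => lt_of_lt_of_le hω hxy).comp (hρ.comp (hξ 0))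
  rw [measureReal_def, strictMaxEvent, measure_biUnion_finset hdisj hmeas]
  rw [Finset.sum_congr rfl fun k hk => by
    rw [measure_strictMax_at hξ hindep hident hρ hD (Finset.notMem_erase k G),
      Finset.card_erase_of_mem hk]]
  rw [Finset.sum_const, nsmul_eq_mul, ENNReal.toReal_mul, ENNReal.toReal_natCast]
  congr 1
  rw [← integral_toReal (hF.pow_const _).aemeasurable
    (ae_of_all _ fun ω => ENNReal.pow_lt_top (measure_lt_top P _))]
  simp [measureReal_def]

theorem iIndepSet_strictMaxEvent (hξ : ∀ k, Measurable (ξ k)) (hindep : iIndepFun ξ P)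
    (hρ : Measurable ρ) (hD : MeasurableSet D) {ι : Type*} {G : ι → Finset ℕ}
    (hG : Pairwise fun i k => Disjoint (G i) (G k)) :
    iIndepSet (fun i => strictMaxEvent ξ ρ D (G i)) P := by
  classical
  have hle : ∀ k, MeasurableSpace.comap (ξ k) mS ≤ mΩ := fun k => (hξ k).comap_le
  have hmeas : ∀ (T : Set ℕ) (i : ι), (G i : Set ℕ) ⊆ T →
      MeasurableSet[⨆ k ∈ T, MeasurableSpace.comap (ξ k) mS] (strictMaxEvent ξ ρ D (G i)) :=
    fun T i hT => measurableSet_strictMaxEvent hρ hD _ fun k hk =>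
      measurable_iff_comap_le.2 (le_iSup₂_of_le k (hT hk) le_rfl)
  rw [iIndepSet_iff_meas_biInter
    (fun i => measurableSet_strictMaxEvent hρ hD mΩ fun k _ => hξ k)]
  intro s
  induction s using Finset.induction_on with
  | empty => simp
  | insert i s hi ih =>
    rw [Finset.set_biInter_insert, Finset.prod_insert hi, ← ih]
    -- The new event and the intersection of the old ones are measurable for variables with disjoint
    -- index sets.
    have hdis : Disjoint (G i : Set ℕ) (⋃ j ∈ s, (G j : Set ℕ)) := by
      rw [Set.disjoint_iUnion₂_right]
      intro j hj
      exact Finset.disjoint_coe.2 (hG fun h => hi (h ▸ hj))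
    have hI := indep_iSup_of_disjoint hle ((iIndepFun_iff_iIndep _ _ _).1 hindep) hdis
    refine (Indep_iff _ _ _).1 hI _ _ (hmeas _ i subset_rfl) ?_
    exact Finset.measurableSet_biInter _ fun j hj => hmeas _ j
      (Set.subset_biUnion_of_mem (u := fun j => (G j : Set ℕ)) hj)

omit mΩ mS in
theorem mem_of_mem_strictMaxEvent {G : Finset ℕ} {ω : Ω} (h : ω ∈ strictMaxEvent ξ ρ D G) {J : ℕ}
    (hJ : J ∈ G) (hmax : ∀ k ∈ G, ρ (ξ k ω) ≤ ρ (ξ J ω)) : ξ J ω ∈ D := by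
  simp only [strictMaxEvent, Set.mem_iUnion, Set.mem_inter_iff, Set.mem_iInter] at h
  obtain ⟨k, hk, h1, h2⟩ := h
  rcases eq_or_ne J k with rfl | hne
  · exact h1
  · exact absurd (h2 J (Finset.mem_erase.2 ⟨hne, hJ⟩)) (not_lt.2 (hmax k hk))

end StrictMax

/-! ### Central limit theorem for bounded triangular arrays -/

section ArrayCLT

/-- Telescoping: factors are exchanged one at a time, each exchange costing at most `δ` because all
the others have norm at most `1`. -/
theorem norm_prod_sub_pow_le {z : ℕ → ℂ} {w : ℂ} {δ : ℝ} (hw : ‖w‖ ≤ 1) (n : ℕ)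
    (hz : ∀ i < n, ‖z i‖ ≤ 1) (hδ : ∀ i < n, ‖z i - w‖ ≤ δ) :
    ‖∏ i ∈ Finset.range n, z i - w ^ n‖ ≤ n * δ := by
  induction n with
  | zero => simp
  | succ n ih =>
    have ih' := ih (fun i hi => hz i (by omega)) (fun i hi => hδ i (by omega))
    rw [Finset.prod_range_succ, pow_succ]
    have heq : (∏ i ∈ Finset.range n, z i) * z n - w ^ n * w
        = (∏ i ∈ Finset.range n, z i - w ^ n) * z n + w ^ n * (z n - w) := by ring
    rw [heq]
    refine (norm_add_le _ _).trans ?_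
    rw [norm_mul, norm_mul, norm_pow]
    have h1 : ‖∏ i ∈ Finset.range n, z i - w ^ n‖ * ‖z n‖ ≤ n * δ :=
      (mul_le_of_le_one_right (norm_nonneg _) (hz n (by omega))).trans ih'
    have h2 : ‖w‖ ^ n * ‖z n - w‖ ≤ δ :=
      (mul_le_of_le_one_left (norm_nonneg _) (pow_le_one₀ (norm_nonneg _) hw)).trans
        (hδ n (by omega))
    push_cast
    linarith

variable {Ω : Type*} [MeasurableSpace Ω] {P : Measure Ω} [IsProbabilityMeasure P]

/-- Second-order Taylor bound for the characteristic function of a centred bounded variable. -/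
theorem norm_charFun_sub_taylor_two_le {X : Ω → ℝ} {b v s : ℝ} (hX : AEMeasurable X P)
    (hb : ∀ ω, |X ω| ≤ b) (h0 : ∫ ω, X ω ∂P = 0) (hv : ∫ ω, X ω ^ 2 ∂P = v) (hs : |s| * b ≤ 1) :
    ‖charFun (P.map X) s - (1 - (s ^ 2 * v / 2 : ℝ))‖ ≤ (|s| * b) ^ 3 := by
  have hI1 : Integrable X P :=
    Integrable.of_bound hX.aestronglyMeasurable b (ae_of_all _ fun ω => by simpa using hb ω)
  have hI2 : Integrable (fun ω => X ω ^ 2) P :=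
    Integrable.of_bound (hX.pow_const 2).aestronglyMeasurable (b ^ 2) (ae_of_all _ fun ω => by
      rw [norm_pow]
      exact pow_le_pow_left₀ (norm_nonneg _) (by simpa using hb ω) 2)
  have hIe : Integrable (fun ω => Complex.exp (s * X ω * Complex.I)) P := by
    refine Integrable.of_bound (by fun_prop) 1 (ae_of_all _ fun ω => ?_)
    rw [← Complex.ofReal_mul, Complex.norm_exp_ofReal_mul_I]
  have hIp : Integrable (fun ω => 1 + (s * Complex.I) * (X ω : ℂ)
      - (s ^ 2 / 2 : ℂ) * ((X ω ^ 2 : ℝ) : ℂ)) P :=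
    ((integrable_const _).add (hI1.ofReal.const_mul _)).sub (hI2.ofReal.const_mul _)
  have hval : ∫ ω, (1 + (s * Complex.I) * (X ω : ℂ)
      - (s ^ 2 / 2 : ℂ) * ((X ω ^ 2 : ℝ) : ℂ)) ∂P = 1 - (s ^ 2 * v / 2 : ℝ) := by
    rw [integral_sub ((integrable_const _).add (hI1.ofReal.const_mul _)) (hI2.ofReal.const_mul _),
      integral_add (integrable_const _) (hI1.ofReal.const_mul _), integral_const_mul,
      integral_const_mul, integral_complex_ofReal, integral_complex_ofReal, h0, hv]
    simp
    ring
  have hchar : charFun (P.map X) s = ∫ ω, Complex.exp (s * X ω * Complex.I) ∂P := by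
    rw [charFun_apply_real, integral_map hX (by fun_prop)]
  rw [hchar, ← hval, ← integral_sub hIe hIp]
  refine (norm_integral_le_of_norm_le_const (C := (|s| * b) ^ 3) (ae_of_all _ fun ω => ?_)).trans
    (by simp)
  have hx : ‖(s * X ω * Complex.I : ℂ)‖ ≤ |s| * b := by
    simp only [norm_mul, Complex.norm_real, Complex.norm_I, mul_one, Real.norm_eq_abs]
    gcongr
    exact hb ω
  -- The remainder is at most `2 / 3!` times the cube of the norm; the factor `1/3` is then dropped.
  have hT := Complex.exp_bound' (x := s * X ω * Complex.I) (n := 3) (by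
    push_cast
    linarith)
  have hsum : ∑ m ∈ Finset.range 3, (s * X ω * Complex.I : ℂ) ^ m / m.factorial
      = 1 + (s * Complex.I) * (X ω : ℂ) - (s ^ 2 / 2 : ℂ) * ((X ω ^ 2 : ℝ) : ℂ) := by
    simp [Finset.sum_range_succ, mul_pow]
    ring
  rw [hsum] at hT
  refine hT.trans ?_
  have h3 := pow_le_pow_left₀ (norm_nonneg _) hx 3
  have h4 : 0 ≤ ‖(s * X ω * Complex.I : ℂ)‖ ^ 3 := by positivity
  norm_num [Nat.factorial]
  simp only [norm_mul, Complex.norm_real, Complex.norm_I, mul_one, Real.norm_eq_abs] at h3 h4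
  linarith

theorem norm_exp_neg_sub_le {y : ℝ} (hy0 : 0 ≤ y) (hy1 : y ≤ 1) :
    ‖(1 - (y : ℂ)) - Complex.exp (-y)‖ ≤ y ^ 2 := by
  have h := Complex.norm_exp_sub_one_sub_id_le (x := -(y : ℂ)) (by simpa [abs_of_nonneg hy0])
  rw [norm_sub_rev]
  simpa [sub_eq_add_neg, add_assoc, add_comm, add_left_comm, abs_of_nonneg hy0] using h

/-- **Central limit theorem for triangular arrays** of row-wise independent, centred, uniformly
bounded random variables, with the same variance along each row and variances tending to `1`. -/
theorem tendstoInDistribution_array {n : ℕ → ℕ} (hn : Tendsto n atTop atTop)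
    {X : ℕ → ℕ → Ω → ℝ} {b : ℝ} {v : ℕ → ℝ}
    (hX : ∀ N, ∀ i < n N, AEMeasurable (X N i) P)
    (hindep : ∀ N, iIndepFun ((Finset.range (n N)).restrict (X N)) P)
    (hb : ∀ N, ∀ i < n N, ∀ ω, |X N i ω| ≤ b)
    (h0 : ∀ N, ∀ i < n N, ∫ ω, X N i ω ∂P = 0)
    (hv : ∀ N, ∀ i < n N, ∫ ω, X N i ω ^ 2 ∂P = v N)
    (hlim : Tendsto v atTop (𝓝 1)) :
    TendstoInDistribution (fun N ω => (√(n N))⁻¹ * ∑ i ∈ Finset.range (n N), X N i ω) atTop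
      (id : ℝ → ℝ) (fun _ => P) (gaussianReal 0 1) where
  forall_aemeasurable N := .const_mul (Finset.aemeasurable_fun_sum _ fun i hi =>
    hX N i (Finset.mem_range.1 hi)) _
  aemeasurable_limit := aemeasurable_id
  tendsto := by
    refine ProbabilityMeasure.tendsto_iff_tendsto_charFun.2 fun t => ?_
    have hsq : Tendsto (fun N => √(n N : ℝ)) atTop atTop :=
      Real.tendsto_sqrt_atTop.comp (tendsto_natCast_atTop_atTop.comp hn)
    have hs : Tendsto (fun N => (√(n N : ℝ))⁻¹ * t) atTop (𝓝 0) := by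
      simpa using (tendsto_inv_atTop_zero.comp hsq).mul_const t
    have hs1 : Tendsto (fun N => |(√(n N : ℝ))⁻¹ * t| * b) atTop (𝓝 0) := by
      simpa using hs.abs.mul_const b
    have hs2 : Tendsto (fun N => ((√(n N : ℝ))⁻¹ * t) ^ 2 * v N / 2) atTop (𝓝 0) := by
      simpa using ((hs.pow 2).mul hlim).div_const 2
    have hmain : Tendsto (fun N => Complex.exp (-(t ^ 2 * v N / 2 : ℝ))) atTop
        (𝓝 (Complex.exp (-(t ^ 2 * 1 / 2 : ℝ)))) := by
      refine (Complex.continuous_exp.tendsto _).comp ?_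
      refine (Complex.continuous_ofReal.neg.tendsto _).comp ?_
      exact (hlim.const_mul _).div_const 2
    -- With `s = t / √n`, the two summands are `n` times the Taylor error `(|s| b)^3` and `n` times
    -- the error `(s² v / 2)^2` of replacing `1 - y` by `exp (-y)`.
    have hbound : Tendsto (fun N => |t| ^ 3 * b ^ 3 * (√(n N : ℝ))⁻¹
        + t ^ 4 * v N ^ 2 / 4 * ((√(n N : ℝ))⁻¹) ^ 2) atTop (𝓝 0) := by
      have hi := tendsto_inv_atTop_zero.comp hsq
      simpa using (hi.const_mul (|t| ^ 3 * b ^ 3)).add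
        ((((hlim.pow 2).const_mul (t ^ 4)).div_const 4).mul (hi.pow 2))
    have hvpos := hlim.eventually_const_lt (show (0 : ℝ) < 1 by norm_num)
    have hdiff : Tendsto (fun N => charFun (P.map fun ω => (√(n N : ℝ))⁻¹ *
        ∑ i ∈ Finset.range (n N), X N i ω) t - Complex.exp (-(t ^ 2 * v N / 2 : ℝ))) atTop
        (𝓝 0) := by
      refine squeeze_zero_norm' ?_ hbound
      filter_upwards [hs1.eventually_le_const zero_lt_one, hs2.eventually_le_const zero_lt_one,
        hvpos, hn.eventually_gt_atTop 0] with N h1 h2 h3 h4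
      set s := (√(n N : ℝ))⁻¹ * t with hsdef
      have hnpos : (0 : ℝ) < n N := Nat.cast_pos.2 h4
      have hqpos : 0 < √(n N : ℝ) := Real.sqrt_pos.2 hnpos
      have hqq : √(n N : ℝ) ^ 2 = n N := Real.sq_sqrt hnpos.le
      rw [charFun_map_mul_comp, (hindep N).charFun_map_fun_finsetSum_eq_prod
        (fun i hi => hX N i (Finset.mem_range.1 hi)), Finset.prod_apply]
      swap
      · exact Finset.aemeasurable_fun_sum _ fun i hi => hX N i (Finset.mem_range.1 hi)
      have hy0 : 0 ≤ s ^ 2 * v N / 2 := by positivity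
      have hw : Complex.exp (-(t ^ 2 * v N / 2 : ℝ))
          = Complex.exp (-((s ^ 2 * v N / 2 : ℝ) : ℂ)) ^ n N := by
        rw [← Complex.exp_nat_mul]
        congr 1
        rw [← Complex.ofReal_neg, ← Complex.ofReal_neg, ← Complex.ofReal_natCast,
          ← Complex.ofReal_mul, ← hqq]
        congr 1
        simp only [hsdef]
        field_simp
      rw [hw]
      refine (norm_prod_sub_pow_le (δ := (|s| * b) ^ 3 + (s ^ 2 * v N / 2) ^ 2) ?_ _ ?_ ?_).trans
        (le_of_eq ?_)
      · rw [← Complex.ofReal_neg, Complex.norm_exp_ofReal]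
        exact Real.exp_le_one_iff.2 (by linarith)
      · intro i hi
        have := Measure.isProbabilityMeasure_map (hX N i hi)
        exact norm_charFun_le_one _
      · intro i hi
        have ha := norm_charFun_sub_taylor_two_le (hX N i hi) (hb N i hi) (h0 N i hi) (hv N i hi) h1
        have hc := norm_exp_neg_sub_le hy0 h2
        exact (norm_sub_le_norm_sub_add_norm_sub _ _ _).trans (add_le_add ha hc)
      · have habs : |s| = (√(n N : ℝ))⁻¹ * |t| := by
          rw [hsdef, abs_mul, abs_of_pos (inv_pos.2 hqpos)]
        rw [habs, hsdef]
        generalize √(n N : ℝ) = q at *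
        rw [← hqq]
        field_simp
        ring
    have := hdiff.add hmain
    simp only [sub_add_cancel, zero_add] at this
    convert! this using 2
    · simp [charFun_gaussianReal]

end ArrayCLT

/-! ### Self-normalization and Slutsky's theorem -/

section SelfNormalized

variable {Ω : Type*} [MeasurableSpace Ω] {P : Measure Ω} [IsProbabilityMeasure P]

omit [IsProbabilityMeasure P] in
theorem MeasureTheory.TendstoInMeasure.comp_continuousAt {U : ℕ → Ω → ℝ} {c : ℝ} {f : ℝ → ℝ}
    (hU : TendstoInMeasure P U atTop fun _ => c) (hf : ContinuousAt f c) :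
    TendstoInMeasure P (fun N ω => f (U N ω)) atTop fun _ => f c := by
  rw [tendstoInMeasure_iff_norm] at hU ⊢
  intro ε hε
  obtain ⟨δ, hδ, h⟩ := Metric.continuousAt_iff.1 hf ε hε
  refine tendsto_of_tendsto_of_tendsto_of_le_of_le tendsto_const_nhds (hU δ hδ)
    (fun _ => zero_le) fun N => measure_mono fun ω (hω : ε ≤ _) => ?_
  by_contra hcon
  exact absurd (h (x := U N ω) (by simpa [dist_eq_norm] using hcon)) (not_lt.2 (by
    simpa [dist_eq_norm] using hω))

theorem tendstoInMeasure_zero_of_integral_abs {U : ℕ → Ω → ℝ} {a : ℕ → ℝ}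
    (hU : ∀ N, Integrable (U N) P) (h : ∀ᶠ N in atTop, ∫ ω, |U N ω| ∂P ≤ a N)
    (ha : Tendsto a atTop (𝓝 0)) :
    TendstoInMeasure P U atTop fun _ => 0 := by
  rw [tendstoInMeasure_iff_measureReal_norm]
  intro ε hε
  have hlim : Tendsto (fun N => a N / ε) atTop (𝓝 0) := by simpa using ha.div_const ε
  refine squeeze_zero' (Eventually.of_forall fun _ => measureReal_nonneg) ?_ hlim
  filter_upwards [h] with N hN
  have := mul_meas_ge_le_integral_of_nonneg (ae_of_all P fun ω => abs_nonneg (U N ω))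
    (hU N).abs ε
  rw [le_div_iff₀ hε, mul_comm]
  simpa using this.trans hN

/-- Portmanteau: the closed set `ε ≤ |x|` contains its frontier and misses `0`, so it is a
continuity set of the limit `δ₀`, with mass zero. -/
theorem tendstoInMeasure_zero_of_tendstoInDistribution {Ω' : Type*} [MeasurableSpace Ω']
    {P' : Measure Ω'} [IsProbabilityMeasure P'] {U : ℕ → Ω → ℝ}
    (h : TendstoInDistribution U atTop (fun _ : Ω' => (0 : ℝ)) (fun _ => P) P') :
    TendstoInMeasure P U atTop fun _ => 0 := by
  rw [tendstoInMeasure_iff_norm]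
  intro ε hε
  set F : Set ℝ := {x | ε ≤ ‖x‖}
  have hF : IsClosed F := isClosed_le continuous_const continuous_norm
  have hmap : P'.map (fun _ => (0 : ℝ)) = Measure.dirac 0 := by simp
  have h0 : (P'.map (fun _ => (0 : ℝ))) F = 0 := by
    rw [hmap, Measure.dirac_apply' _ hF.measurableSet]
    simp [F, hε]
  have := ProbabilityMeasure.tendsto_measure_of_null_frontier_of_tendsto' h.tendsto (E := F)
    (measure_mono_null hF.frontier_subset h0)
  simp only [ProbabilityMeasure.coe_mk] at this
  rw [h0] at this
  refine this.congr fun N => ?_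
  rw [Measure.map_apply_of_aemeasurable (h.forall_aemeasurable N) hF.measurableSet]
  simp [F]

/-- Asymptotic normality of the self-normalized mean of `{0, 1}`-valued variables `η N i` that
dominate the indicators of independent events `A N i` and differ little from them in mean. -/
theorem tendstoInDistribution_selfNormalized {n : ℕ → ℕ} (hn : Tendsto n atTop atTop)
    {η : ℕ → ℕ → Ω → ℝ} {A : ℕ → ℕ → Set Ω} {p a : ℕ → ℝ} {q : ℝ} (hq0 : 0 < q) (hq1 : q < 1)
    (hη : ∀ N, ∀ i < n N, Measurable (η N i))
    (hη01 : ∀ N, ∀ i < n N, ∀ ω, η N i ω = 0 ∨ η N i ω = 1)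
    (hA : ∀ N, ∀ i < n N, MeasurableSet (A N i))
    (hindep : ∀ N, iIndepSet (fun i : Finset.range (n N) => A N i) P)
    (hAη : ∀ N, ∀ i < n N, ∀ ω ∈ A N i, η N i ω = 1)
    (hp : ∀ N, ∀ i < n N, P.real (A N i) = p N)
    (hpq : ∀ᶠ N in atTop, |p N - q| ≤ a N)
    (hηp : ∀ᶠ N in atTop, ∀ i < n N, ∫ ω, η N i ω ∂P - p N ≤ 2 * a N)
    (ha : Tendsto (fun N => √(n N) * a N) atTop (𝓝 0)) :
    TendstoInDistribution (fun N ω => √(n N) *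
        ((1 / (n N : ℝ)) * ∑ i ∈ Finset.range (n N), η N i ω - q) /
        √((1 / (n N : ℝ)) * ∑ i ∈ Finset.range (n N), η N i ω ^ 2
          - ((1 / (n N : ℝ)) * ∑ i ∈ Finset.range (n N), η N i ω) ^ 2))
      atTop (id : ℝ → ℝ) (fun _ => P) (gaussianReal 0 1) := by
  set v := q * (1 - q) with hvdef
  have hv : 0 < v := mul_pos hq0 (sub_pos.2 hq1)
  have hsv : 0 < √v := Real.sqrt_pos.2 hv
  set I : ℕ → ℕ → Ω → ℝ := fun N i => (A N i).indicator 1 with hI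
  have hI01 : ∀ N i ω, I N i ω = 0 ∨ I N i ω = 1 := fun N i ω => by
    by_cases h : ω ∈ A N i <;> simp [hI, h]
  have hIm : ∀ N, ∀ i < n N, Measurable (I N i) := fun N i hi =>
    measurable_one.indicator (hA N i hi)
  have hIint : ∀ N, ∀ i < n N, ∫ ω, I N i ω ∂P = p N := fun N i hi => by
    rw [← hp N i hi]; exact integral_indicator_one (hA N i hi)
  have hIη : ∀ N, ∀ i < n N, ∀ ω, I N i ω ≤ η N i ω := fun N i hi ω => by
    by_cases h : ω ∈ A N i
    · simp [hI, h, hAη N i hi ω h]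
    · rcases hη01 N i hi ω with h' | h' <;> simp [hI, h, h']
  have hII : ∀ N, ∀ i < n N, Integrable (I N i) P := fun N i hi =>
    Integrable.of_bound (hIm N i hi).aestronglyMeasurable 1 (ae_of_all _ fun ω => by
      rcases hI01 N i ω with h | h <;> simp [h])
  have hηI : ∀ N, ∀ i < n N, Integrable (η N i) P := fun N i hi =>
    Integrable.of_bound (hη N i hi).aestronglyMeasurable 1 (ae_of_all _ fun ω => by
      rcases hη01 N i hi ω with h | h <;> simp [h])
  have hsq : Tendsto (fun N => √(n N : ℝ)) atTop atTop :=
    Real.tendsto_sqrt_atTop.comp (tendsto_natCast_atTop_atTop.comp hn)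
  have hsqi : Tendsto (fun N => (√(n N : ℝ))⁻¹) atTop (𝓝 0) := tendsto_inv_atTop_zero.comp hsq
  have hnpos := hn.eventually_gt_atTop 0
  have ha0 : Tendsto a atTop (𝓝 0) := by
    have := hsqi.mul ha
    rw [zero_mul] at this
    refine this.congr' ?_
    filter_upwards [hnpos] with N hN
    have : 0 < √(n N : ℝ) := Real.sqrt_pos.2 (Nat.cast_pos.2 hN)
    field_simp
  have hplim : Tendsto p atTop (𝓝 q) := by
    rw [tendsto_iff_norm_sub_tendsto_zero]
    exact squeeze_zero' (Eventually.of_forall fun _ => norm_nonneg _) hpq ha0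
  -- the independent part
  have hclt := tendstoInDistribution_array (P := P) hn
    (X := fun N i ω => (I N i ω - p N) / √v) (b := 1 / √v) (v := fun N => p N * (1 - p N) / v)
    (fun N i hi => (((hIm N i hi).sub_const _).div_const _).aemeasurable)
    (fun N => by
      have := (hindep N).iIndepFun_indicator (m := Real.measurableSpace)
      exact this.comp (fun _ x => (x - p N) / √v) fun _ => by fun_prop)
    (fun N i hi ω => by
      rw [abs_div, abs_of_pos hsv]
      gcongr
      have h0 : 0 ≤ p N := hp N i hi ▸ measureReal_nonneg
      have h1 : p N ≤ 1 := hp N i hi ▸ measureReal_le_one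
      rw [abs_le]
      rcases hI01 N i ω with h | h <;> rw [h] <;> constructor <;> linarith)
    (fun N i hi => by
      rw [integral_div, integral_sub (hII N i hi) (integrable_const _), hIint N i hi]
      simp)
    (fun N i hi => by
      have : ∀ ω, ((I N i ω - p N) / √v) ^ 2 = ((1 - 2 * p N) * I N i ω + p N ^ 2) / v := by
        intro ω
        rw [div_pow, Real.sq_sqrt hv.le]
        rcases hI01 N i ω with h | h <;> rw [h] <;> ring
      simp only [this]
      rw [integral_div, integral_add ((hII N i hi).const_mul _) (integrable_const _),
        integral_const_mul, hIint N i hi]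
      simp
      ring)
    (by
      have := (hplim.mul (hplim.const_sub 1)).div_const v
      rwa [← hvdef, div_self hv.ne'] at this)
  -- the remainder
  set M : ℕ → Ω → ℝ := fun N ω => (1 / (n N : ℝ)) * ∑ i ∈ Finset.range (n N), η N i ω with hM
  -- Excess of `η` over the independent indicators, plus the bias of `p N`. The excess is
  -- nonnegative, so its `L¹` norm is its mean: `2 √n a` from the excess and `√n a` from the bias
  -- give the constant `3`.
  set r : ℕ → Ω → ℝ := fun N ω => √(n N) * ((1 / (n N : ℝ)) *
    ∑ i ∈ Finset.range (n N), (η N i ω - I N i ω)) + √(n N) * (p N - q) with hr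
  have hMm : ∀ N, Measurable (M N) := fun N =>
    (Finset.measurable_sum _ fun i hi => hη N i (Finset.mem_range.1 hi)).const_mul _
  have hdI : ∀ N, ∀ i ∈ Finset.range (n N), Integrable (fun ω => η N i ω - I N i ω) P :=
    fun N i hi => (hηI N i (Finset.mem_range.1 hi)).sub (hII N i (Finset.mem_range.1 hi))
  have hr1 : ∀ N, Integrable (fun ω => √(n N) * ((1 / (n N : ℝ)) *
      ∑ i ∈ Finset.range (n N), (η N i ω - I N i ω))) P := fun N =>
    ((integrable_finsetSum _ (hdI N)).const_mul _).const_mul _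
  have hrint : ∀ N, Integrable (r N) P := fun N => (hr1 N).add (integrable_const _)
  have hr0 : TendstoInMeasure P (fun N ω => r N ω / √v) atTop fun _ => 0 := by
    refine tendstoInMeasure_zero_of_integral_abs (a := fun N => 3 * (√(n N) * a N) / √v)
      (fun N => (hrint N).div_const _) ?_ (by simpa using (ha.const_mul 3).div_const (√v))
    filter_upwards [hpq, hηp, hnpos] with N h1 h2 h3
    have hn' : (0 : ℝ) < n N := Nat.cast_pos.2 h3
    have hq' : 0 ≤ √(n N : ℝ) := Real.sqrt_nonneg _
    simp only [abs_div, abs_of_pos hsv]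
    rw [integral_div]
    refine div_le_div_of_nonneg_right ?_ hsv.le
    calc ∫ ω, |r N ω| ∂P
        ≤ ∫ ω, (√(n N) * ((1 / (n N : ℝ)) * ∑ i ∈ Finset.range (n N), (η N i ω - I N i ω))
            + √(n N) * a N) ∂P := by
          refine integral_mono (hrint N).abs ((hr1 N).add (integrable_const _)) fun ω => ?_
          refine (abs_add_le _ _).trans (add_le_add (le_of_eq (abs_of_nonneg ?_)) ?_)
          · refine mul_nonneg hq' (mul_nonneg (by positivity) (Finset.sum_nonneg fun i hi => ?_))
            exact sub_nonneg.2 (hIη N i (Finset.mem_range.1 hi) ω)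
          · rw [abs_mul, abs_of_nonneg hq']
            gcongr
      _ = √(n N) * ((1 / (n N : ℝ)) * ∑ i ∈ Finset.range (n N), (∫ ω, η N i ω ∂P - p N))
            + √(n N) * a N := by
          rw [integral_add (hr1 N) (integrable_const _), integral_const_mul, integral_const_mul,
            integral_finsetSum _ (hdI N)]
          simp only [integral_const, probReal_univ, one_smul]
          congr 3
          refine Finset.sum_congr rfl fun i hi => ?_
          rw [integral_sub (hηI N i (Finset.mem_range.1 hi)) (hII N i (Finset.mem_range.1 hi)),
            hIint N i (Finset.mem_range.1 hi)]
      _ ≤ √(n N) * ((1 / (n N : ℝ)) * ∑ i ∈ Finset.range (n N), 2 * a N) + √(n N) * a N := by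
          gcongr with i hi
          exact h2 i (Finset.mem_range.1 hi)
      _ = 3 * (√(n N) * a N) := by
          simp only [Finset.sum_const, Finset.card_range, nsmul_eq_mul]
          field_simp
          ring
  have hW := hclt.add_of_tendstoInMeasure_const hr0 fun N => ((hrint N).div_const _).aemeasurable
  set W : ℕ → Ω → ℝ := fun N ω => √(n N) * (M N ω - q) / √v with hWdef
  have hWeq : (fun N => (fun ω => (√(n N : ℝ))⁻¹ *
      ∑ i ∈ Finset.range (n N), (I N i ω - p N) / √v) + fun ω => r N ω / √v) = W := by
    funext N ω
    simp only [hWdef, hr, hM, Pi.add_apply, ← Finset.sum_div, Finset.sum_sub_distrib,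
      Finset.sum_const, Finset.card_range, nsmul_eq_mul]
    rcases Nat.eq_zero_or_pos (n N) with h | h
    · simp [h]
    · have hn' : (0 : ℝ) < n N := Nat.cast_pos.2 h
      have hq' : 0 < √(n N : ℝ) := Real.sqrt_pos.2 hn'
      have hqq : √(n N : ℝ) ^ 2 = n N := Real.sq_sqrt hn'.le
      generalize √(n N : ℝ) = s at *
      rw [← hqq]
      field_simp
      ring
  have hW' : TendstoInDistribution W atTop (id : ℝ → ℝ) (fun _ => P) (gaussianReal 0 1) := by
    rw [← hWeq]
    simpa only [add_zero] using! hW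
  -- consistency of the mean
  have hconst : TendstoInMeasure P (fun N (_ : Ω) => (√(n N : ℝ))⁻¹) atTop fun _ => 0 :=
    tendstoInMeasure_of_tendsto_ae (fun _ => aestronglyMeasurable_const) (ae_of_all _ fun _ => hsqi)
  -- `M N - q` is a convergent-in-law sequence divided by `√n`, so no separate law of large numbers
  -- is needed.
  have hU : TendstoInMeasure P (fun N ω => √v * (W N ω * (√(n N : ℝ))⁻¹)) atTop fun _ => 0 := by
    refine tendstoInMeasure_zero_of_tendstoInDistribution (P' := gaussianReal 0 1) ?_
    simpa using hW'.continuous_comp_prodMk_of_tendstoInMeasure_const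
      (g := fun x : ℝ × ℝ => √v * (x.1 * x.2)) (by fun_prop) hconst fun _ => aemeasurable_const
  have hMq : TendstoInMeasure P M atTop fun _ => q := by
    have h1 := hU.comp_continuousAt (f := fun x => q + x) (by fun_prop)
    simp only [add_zero] at h1
    refine h1.congr' ?_ (ae_of_all _ fun _ => rfl)
    filter_upwards [hnpos] with N hN
    refine ae_of_all _ fun ω => ?_
    have hq' : 0 < √(n N : ℝ) := Real.sqrt_pos.2 (Nat.cast_pos.2 hN)
    simp only [hWdef]
    field_simp
    ring
  have hden : TendstoInMeasure P (fun N ω => √v / √(M N ω - M N ω ^ 2)) atTop fun _ => 1 := by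
    have hqv : q - q ^ 2 = v := by rw [hvdef]; ring
    have hc : ContinuousAt (fun x : ℝ => √v / √(x - x ^ 2)) q := by
      refine ContinuousAt.div continuousAt_const (by fun_prop) ?_
      rw [hqv]
      exact hsv.ne'
    have := hMq.comp_continuousAt hc
    rwa [hqv, div_self hsv.ne'] at this
  have hT := hW'.continuous_comp_prodMk_of_tendstoInMeasure_const
    (g := fun x : ℝ × ℝ => x.1 * x.2) (by fun_prop) hden fun N =>
      (((hMm N).sub ((hMm N).pow_const 2)).sqrt.const_div _).aemeasurable
  simp only [mul_one] at hT
  convert! hT using 3 with N ω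
  -- Since `η² = η`, the empirical variance is `M - M²`.
  have hsq2 : ∑ i ∈ Finset.range (n N), η N i ω ^ 2 = ∑ i ∈ Finset.range (n N), η N i ω :=
    Finset.sum_congr rfl fun i hi => by
      rcases hη01 N i (Finset.mem_range.1 hi) ω with h | h <;> simp [h]
  rw [hsq2]
  change _ = √(n N) * (M N ω - q) / √v * (√v / √(M N ω - M N ω ^ 2))
  -- Only `√v ≠ 0` is used: where the empirical variance vanishes, both sides are `0`.
  rw [div_mul_div_comm, mul_comm (√v), mul_div_mul_right _ _ hsv.ne']

end SelfNormalized

/-! ### Application to normed cones -/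

namespace NormedCone

variable {K : Type*} [AddCommMonoid K] [EMetricSpace K] [DistribMulAction PosScalar K]
  [NormedCone K] [MeasurableSpace K] [BorelSpace K]

theorem measurable_radius : Measurable (radius : punctured K → ℝ) :=
  (measurable_edist_left.comp measurable_subtype_coe).ennreal_toReal

theorem measurable_direction : Measurable (direction : punctured K → unitSphere K) := by
  have := polish (K := K)
  have := continuousSMul (K := K)
  have h : Measurable fun p : PosScalar × K => p.1 • p.2 := continuous_smul.measurable
  refine Measurable.subtype_mk (h.comp (Measurable.prodMk (Measurable.subtype_mk ?_)
    measurable_subtype_coe))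
  exact measurable_radius.inv

variable {Ω : Type*} [MeasurableSpace Ω] {P : Measure Ω} [IsProbabilityMeasure P]
  {ξ : ℕ → Ω → punctured K} {σ : Measure (unitSphere K)} [IsProbabilityMeasure σ] {α β : ℝ}

theorem exists_strictMax_lower_bound (hξ : ∀ k, Measurable (ξ k)) (hindep : iIndepFun ξ P)
    (hident : ∀ k, IdentDistrib (ξ k) (ξ 0) P P) (hα : 0 < α) (hαβ : α < β)
    (htail : StrongSecondOrder P (ξ 0) σ α β) {ζ : ℝ} (hζ0 : 0 ≤ ζ) (hζ1 : ζ ≤ 1)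
    (hζ : ζ ≤ (β - α) / α) {B : Set (unitSphere K)} (hB : MeasurableSet B)
    (hσB : σ (frontier B) = 0) :
    ∃ D : ℝ, 0 ≤ D ∧ ∀ G : Finset ℕ, 2 ≤ G.card → σ.real B - D * (G.card : ℝ) ^ (-ζ)
      ≤ P.real (strictMaxEvent ξ radius (direction ⁻¹' B) G) := by
  obtain ⟨C, hC⟩ := htail B hB hσB
  -- The whole sphere has empty frontier and mass `1`, which yields the tail of the radius alone.
  obtain ⟨C', hC'⟩ := htail Set.univ MeasurableSet.univ (by simp)
  simp only [Set.mem_univ, true_and, probReal_univ] at hC'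
  obtain ⟨D, hD, h⟩ := exists_tail_lower_bound (E := ξ 0 ⁻¹' (direction ⁻¹' B)) hα hαβ
    measureReal_nonneg measureReal_le_one hC hC'
  have hR : Measurable fun ω => radius (ξ 0 ω) := measurable_radius.comp (hξ 0)
  refine ⟨3 * D, by positivity, fun G hG => ?_⟩
  rw [measureReal_strictMaxEvent hξ hindep hident measurable_radius (measurable_direction hB)]
  refine integral_pow_lower_bound hR hD hζ0 hζ1 (fun t ht0 ht1 => ?_) hG
  refine le_trans ?_ (quantile_tail_lower_bound hR (fun ω => radius_pos _) measureReal_nonneg hD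
    (div_pos (hα.trans hαβ) hα).le h ht0 ht1)
  -- As `1 - t ≤ 1`, lowering the exponent from `β / α` to `1 + ζ` only weakens the bound.
  have he : 1 + ζ ≤ β / α := by
    rw [sub_div, div_self hα.ne'] at hζ
    linarith
  have := Real.rpow_le_rpow_of_exponent_ge (sub_pos.2 ht1) (by linarith) he
  gcongr

end NormedCone

namespace NormedCone

theorem spectralEstimator_real {K : Type*} [AddCommMonoid K] [EMetricSpace K]
    [DistribMulAction PosScalar K] [NormedCone K] [MeasurableSpace K] {B : Set (unitSphere K)}
    (hB : MeasurableSet B) (n : ℕ) (θ : ℕ → unitSphere K) :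
    (spectralEstimator n θ).real B
      = (1 / (n : ℝ)) * ∑ i ∈ Finset.range n, B.indicator (fun _ => (1 : ℝ)) (θ i) := by
  rw [measureReal_def, spectralEstimator, Measure.smul_apply, Measure.finsetSum_apply, smul_eq_mul,
    ENNReal.toReal_mul, ENNReal.toReal_sum fun i _ => measure_ne_top _ _]
  congr 1
  · simp
  · refine Finset.sum_congr rfl fun i _ => ?_
    rw [Measure.dirac_apply' _ hB]
    by_cases h : θ i ∈ B <;> simp [h]

end NormedCone

/-- The terms `ζ / (1 + 2 ζ)` cancel in the exponent of `N`, leaving `-(ε / 2 + ε ζ)`. This is where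
the sizes of `n` and `m` are balanced. -/
theorem tendsto_sqrt_mul_rpow_neg {ζ ε : ℝ} (hζ : 0 < ζ) (hε : 0 < ε) {n m : ℕ → ℕ}
    (hn : (fun N => (n N : ℝ)) ~[atTop] fun N => (N : ℝ) ^ (2 * ζ / (1 + 2 * ζ) - ε))
    (hm : (fun N => (m N : ℝ)) ~[atTop] fun N => (N : ℝ) ^ (1 / (1 + 2 * ζ) + ε)) :
    Tendsto (fun N => √(n N : ℝ) * (m N : ℝ) ^ (-ζ)) atTop (𝓝 0) := by
  have h1 := hn.rpow (fun N => by positivity) (r := 1 / 2)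
  have h2 := hm.rpow (fun N => by positivity) (r := -ζ)
  refine (h1.mul h2).symm.tendsto_nhds (c := 0) ?_ |>.congr fun N => ?_
  · have hlim : Tendsto (fun N : ℕ => (N : ℝ) ^ (-(ε / 2 + ε * ζ))) atTop (𝓝 0) :=
      (tendsto_rpow_neg_atTop (by positivity)).comp tendsto_natCast_atTop_atTop
    refine hlim.congr' ?_
    filter_upwards [eventually_gt_atTop 0] with N hN
    have hN' : (0 : ℝ) < N := Nat.cast_pos.2 hN
    simp only [Pi.mul_apply, Pi.pow_apply]
    rw [← Real.rpow_mul hN'.le, ← Real.rpow_mul hN'.le, ← Real.rpow_add hN']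
    congr 1
    field_simp
    ring
  · simp [Real.sqrt_eq_rpow]

theorem mainTheorem6
    {K : Type*} [AddCommMonoid K] [EMetricSpace K] [DistribMulAction PosScalar K] [NormedCone K]
    [MeasurableSpace K] [BorelSpace K]
    {Ω : Type*} [MeasurableSpace Ω] (P : Measure Ω) [IsProbabilityMeasure P]
    (ξ : ℕ → Ω → NormedCone.punctured K)
    (hξ_meas : ∀ k, Measurable (ξ k))
    (hξ_indep : iIndepFun ξ P)
    (hξ_ident : ∀ k, IdentDistrib (ξ k) (ξ 0) P P)
    (σ : Measure (NormedCone.unitSphere K)) [IsProbabilityMeasure σ]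
    (α β : ℝ) (hα : 0 < α) (hαβ : α < β)
    (hξ_tail : NormedCone.StrongSecondOrder P (ξ 0) σ α β)
    (B : Set (NormedCone.unitSphere K)) (hB : MeasurableSet B) (hσB : σ (frontier B) = 0)
    (hB_pos : 0 < σ.real B) (hB_lt : σ.real B < 1)
    (ζ : ℝ) (hζ : ζ = min ((β - α) / α) 1)
    (ε : ℝ) (hε : 0 < ε) (hε_lt : ε < 2 * ζ / (1 + 2 * ζ))
    (n m : ℕ → ℕ)
    (hn : (fun N => (n N : ℝ)) ~[atTop] fun N => (N : ℝ) ^ (2 * ζ / (1 + 2 * ζ) - ε))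
    (hm : (fun N => (m N : ℝ)) ~[atTop] fun N => (N : ℝ) ^ (1 / (1 + 2 * ζ) + ε))
    (G : ℕ → ℕ → Finset ℕ) (hG : ∀ N, NormedCone.IsGrouping N (n N) (m N) (G N))
    (J : ℕ → ℕ → Ω → ℕ)
    (hJ : ∀ N, ∀ i < n N, NormedCone.IsMaxIndex ξ (G N i) (J N i)) :
    TendstoInDistribution
      (fun N ω => NormedCone.selfNormalizedStat σ B (n N)
        (fun i => NormedCone.direction (ξ (J N i ω) ω)))
      atTop (id : ℝ → ℝ) (fun _ => P) (gaussianReal 0 1) := by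
  have hζ0 : 0 < ζ := hζ ▸ lt_min (div_pos (sub_pos.2 hαβ) hα) one_pos
  have hζ1 : ζ ≤ 1 := hζ ▸ min_le_right _ _
  have hζ2 : ζ ≤ (β - α) / α := hζ ▸ min_le_left _ _
  have hnT : Tendsto n atTop atTop := tendsto_natCast_atTop_iff.1 <|
    hn.symm.tendsto_atTop ((tendsto_rpow_atTop (sub_pos.2 hε_lt)).comp tendsto_natCast_atTop_atTop)
  have hmT : Tendsto m atTop atTop := tendsto_natCast_atTop_iff.1 <|
    hm.symm.tendsto_atTop ((tendsto_rpow_atTop (by positivity)).comp tendsto_natCast_atTop_atTop)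
  obtain ⟨D₁, hD₁, h1⟩ := NormedCone.exists_strictMax_lower_bound hξ_meas hξ_indep hξ_ident hα hαβ
    hξ_tail hζ0.le hζ1 hζ2 hB hσB
  obtain ⟨D₂, hD₂, h2⟩ := NormedCone.exists_strictMax_lower_bound hξ_meas hξ_indep hξ_ident hα hαβ
    hξ_tail hζ0.le hζ1 hζ2 hB.compl (by rwa [frontier_compl])
  rw [probReal_compl_eq_one_sub hB] at h2
  have hdir := NormedCone.measurable_direction (K := K)
  set E : ℕ → ℕ → Set Ω := fun N i =>
    strictMaxEvent ξ NormedCone.radius (NormedCone.direction ⁻¹' B) (G N i)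
  set H : ℕ → ℕ → Set Ω := fun N i => {ω | NormedCone.direction (ξ (J N i ω) ω) ∈ B}
  have hθ : ∀ N, ∀ i < n N, Measurable fun ω => NormedCone.direction (ξ (J N i ω) ω) :=
    fun N i hi => hdir.comp <| (measurable_from_prod_countable_right
      (f := fun x : ℕ × Ω => ξ x.1 x.2) hξ_meas).comp ((hJ N i hi).measurable.prodMk measurable_id)
  have hH : ∀ N, ∀ i < n N, MeasurableSet (H N i) := fun N i hi => hθ N i hi hB
  have hEH : ∀ N, ∀ i < n N, E N i ⊆ H N i := fun N i hi ω hω =>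
    mem_of_mem_strictMaxEvent hω ((hJ N i hi).mem ω) ((hJ N i hi).radius_le ω)
  have hbounds : ∀ N, 2 ≤ m N → ∀ i < n N,
      σ.real B - D₁ * (m N : ℝ) ^ (-ζ) ≤ P.real (E N i) ∧ P.real (E N i) ≤ P.real (H N i) ∧
        P.real (H N i) ≤ σ.real B + D₂ * (m N : ℝ) ^ (-ζ) := by
    intro N hmN i hi
    have hc := (hG N).card_eq i hi
    have h1' := h1 (G N i) (hc.symm ▸ hmN)
    have h2' := h2 (G N i) (hc.symm ▸ hmN)
    rw [hc] at h1' h2'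
    -- A strict maximum with direction outside `B` is necessarily the one selected, so the lower
    -- bound for `Bᶜ` becomes an upper bound for `H N i`.
    have hsub : strictMaxEvent ξ NormedCone.radius (NormedCone.direction ⁻¹' Bᶜ) (G N i)
        ⊆ (H N i)ᶜ := fun ω hω =>
      mem_of_mem_strictMaxEvent hω ((hJ N i hi).mem ω) ((hJ N i hi).radius_le ω)
    have h3 := measureReal_mono (μ := P) hsub
    rw [probReal_compl_eq_one_sub (hH N i hi)] at h3
    exact ⟨h1', measureReal_mono (hEH N i hi), by linarith⟩
  have hint : ∀ N, ∀ i < n N,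
      ∫ ω, B.indicator (fun _ => (1 : ℝ)) (NormedCone.direction (ξ (J N i ω) ω)) ∂P
        = P.real (H N i) := fun N i hi => integral_indicator_one (hH N i hi)
  have hmev := hmT.eventually_ge_atTop 2
  have hpE : ∀ N, ∀ i < n N, P.real (E N i) = P.real (E N 0) := fun N i hi => by
    simp only [E]
    rw [measureReal_strictMaxEvent hξ_meas hξ_indep hξ_ident NormedCone.measurable_radius (hdir hB),
      measureReal_strictMaxEvent hξ_meas hξ_indep hξ_ident NormedCone.measurable_radius (hdir hB),
      (hG N).card_eq i hi, (hG N).card_eq 0 (by omega)]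
  have hmain := tendstoInDistribution_selfNormalized (P := P) hnT
    (η := fun N i ω => B.indicator (fun _ => (1 : ℝ)) (NormedCone.direction (ξ (J N i ω) ω)))
    -- `D₁ + D₂` bounds the gap between the upper bound for `H N i` and the lower bound for `E N i`,
    -- in units of `m^{-ζ}`.
    (A := E) (p := fun N => P.real (E N 0)) (a := fun N => (D₁ + D₂) * (m N : ℝ) ^ (-ζ))
    hB_pos hB_lt
    (fun N i hi => (measurable_const.indicator hB).comp (hθ N i hi))
    (fun N i hi ω => by
      by_cases h : NormedCone.direction (ξ (J N i ω) ω) ∈ B <;> simp [h])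
    (fun N i hi => measurableSet_strictMaxEvent NormedCone.measurable_radius (hdir hB) _
      fun k _ => hξ_meas k)
    (fun N => iIndepSet_strictMaxEvent hξ_meas hξ_indep NormedCone.measurable_radius (hdir hB)
      (G := fun i : Finset.range (n N) => G N i) fun i k hik =>
        (hG N).disjoint i (Finset.mem_range.1 i.2) k (Finset.mem_range.1 k.2)
          (fun h => hik (Subtype.ext h)))
    (fun N i hi ω hω => Set.indicator_of_mem (s := B)
      (show NormedCone.direction (ξ (J N i ω) ω) ∈ B from hEH N i hi hω) _)
    hpE
    (by
      filter_upwards [hmev, hnT.eventually_gt_atTop 0] with N h3 h4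
      obtain ⟨ha, hb, hc⟩ := hbounds N h3 0 h4
      have hp : 0 ≤ (m N : ℝ) ^ (-ζ) := by positivity
      have hp1 := mul_nonneg hD₁ hp
      have hp2 := mul_nonneg hD₂ hp
      rw [abs_le]
      constructor <;> linarith)
    (by
      filter_upwards [hmev] with N h3 i hi
      obtain ⟨ha, hb, hc⟩ := hbounds N h3 i hi
      have hp : 0 ≤ (m N : ℝ) ^ (-ζ) := by positivity
      have hp1 := mul_nonneg hD₁ hp
      have hp2 := mul_nonneg hD₂ hp
      rw [hint N i hi, ← hpE N i hi]
      linarith)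
    (by
      have := (tendsto_sqrt_mul_rpow_neg hζ0 hε hn hm).const_mul (D₁ + D₂)
      rw [mul_zero] at this
      exact this.congr fun N => by ring)
  simpa only [NormedCone.selfNormalizedStat, NormedCone.spectralEstimator_real hB] using hmain
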